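/- All $^*$-algebras are associative, unital and over $\mathbb{C}$. For such a $^*$-algebra $\mathcal{A}$ let $\mathcal{A}_H=\{a: a^*=a\}$ and let $\mathcal{A}^*$ be the algebraic dual. For $\omega\in\mathcal{A}^*$ put $\omega^*(a)=\overline{\omega(a^*)}$, $(b\cdot\omega\cdot c)(a)=\omega(cab)$ and $(b\triangleright\omega)(a)=\omega(b^*ab)$, and let $\mathcal{A}^*_H=\{\omega:\omega^*=\omega\}$. A functional $\omega\in\mathcal{A}^*$ is algebraically positive if $\omega(a^*a)\ge 0$ for all $a\in\mathcal{A}$. A quasi-ordered $^*$-algebra is a $^*$-algebra $\mathcal{A}$ with a reflexive and transitive relation $\lesssim$ on $\mathcal{A}_H$ such that $0\lesssim 1$ and such that $a\lesssim b$ implies $a+c\lesssim b+c$ and $d^*ad\lesssim d^*bd$ for all $c\in\mathcal{A}_H$, $d\in\mathcal{A}$. Put $\mathcal{A}^+_H=\{a\in\mathcal{A}_H:0\lesssim a\}$. For $\omega,\rho\in\mathcal{A}^*_H$ write $\omega\le\rho$ if $\omega(a)\le\rho(a)$ for all $a\in\mathcal{A}^+_H$, and let $\mathcal{A}^{*,+}_H=\{\omega\in\mathcal{A}^*_H:0\le\omega\}$.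 An abstract $O^*$-algebra $(\mathcal{A},\Omega)$ is a quasi-ordered $^*$-algebra $\mathcal{A}$ with a linear subspace and $\mathcal{A}$-subbimodule $\Omega\subseteq\mathcal{A}^*$, stable under $\omega\mapsto\omega^*$, such that, with $\Omega^+_H=\Omega\cap\mathcal{A}^{*,+}_H$, the space $\Omega$ is the linear span of $\Omega^+_H$, and $\mathcal{A}^+_H=\{a\in\mathcal{A}_H:\omega(a)\ge0\text{ for all }\omega\in\Omega^+_H\}$. Its states are the $\omega\in\Omega^+_H$ with $\omega(1)=1$; its strong topology is the locally convex topology on $\mathcal{A}$ defined by the seminorms $a\mapsto\sqrt{\omega(a^*a)}$, $\omega\in\Omega^+_H$. $(\mathcal{A},\Omega)$ is downwards closed if every $\rho\in\mathcal{A}^{*,+}_H$ for which there is an $\omega\in\Omega^+_H$ with $\omega-\rho\in\mathcal{A}^{*,+}_H$ belongs to $\Omega^+_H$. A state $\omega$ is a Stieltjes state for $a\in\mathcal{A}^+_H$ if for all $b\in\mathcal{A}$ with $\omega(b^*b)=1$ one has $(b\triangleright\omega)(a)=0$ or $\sum_{n=1}^\infty \big((b\triangleright\omega)(a^n)\big)^{-1/(2n)}=\infty$.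 An element $q\in\mathcal{A}^+_H$ is coercive if $\epsilon 1\lesssim q$ for some $\epsilon>0$. For a set $Q\subseteq\mathcal{A}_H$ let $$Q^\downarrow=\{a\in\mathcal{A}:\ \forall q\in Q\ \exists r,s\in Q:\ a^*q^2a\lesssim r^2\text{ and }aq^2a^*\lesssim s^2\}.$$ $(\mathcal{A},\Omega)$ has sufficiently many Stieltjes states if there is a non-empty set $Q'\subseteq\mathcal{A}^+_H$ of coercive and pairwise commuting elements such that every state is a Stieltjes state for every $q'\in Q'$, and such that $Q^\downarrow\cap\mathcal{A}^+_H$ is dense in $\mathcal{A}^+_H$ for the strong topology, where $Q=\{\lambda q_1'\cdots q_N':\lambda\in[1,\infty),\ N\ge1,\ q_1',\dots,q_N'\in Q'\}$. **Proposition.** Let $(\mathcal{A},\Omega)$ be a downwards closed abstract $O^*$-algebra with sufficiently many Stieltjes states, let $\omega\in\Omega^+_H$, and let $\rho\in\mathcal{A}^*_H$ be algebraically positive and such that $\omega-\rho$ is also algebraically positive. Then $\rho\in\Omega^+_H$ and $0\le\rho\le\omega$. -/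

import Mathlib

open scoped ComplexOrder ENNReal

noncomputable section

namespace OStar

section Dual

variable {A : Type*} [Ring A] [StarRing A] [Algebra ℂ A]

/-- The antilinear involution on the algebraic dual: `ω* (a) = conj (ω (a*))`. -/
def dualStar [StarModule ℂ A] (ω : Module.Dual ℂ A) : Module.Dual ℂ A where
  toFun a := star (ω (star a))
  map_add' a b := by simp
  map_smul' c a := by simp [star_smul]

/-- Hermitian linear functionals. -/
def hermitianDual (A : Type*) [Ring A] [StarRing A] [Algebra ℂ A] [StarModule ℂ A] :
    Set (Module.Dual ℂ A) :=
  {ω | dualStar ω = ω}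

/-- Algebraically positive linear functionals: `0 ≤ ω (a* a)` (so `ω (a* a)` is real). -/
def AlgPositive (ω : Module.Dual ℂ A) : Prop :=
  ∀ a : A, 0 ≤ ω (star a * a)

/-- The bimodule structure on the dual: `(b · ω · c) (a) = ω (c a b)`. -/
def bimul (b : A) (ω : Module.Dual ℂ A) (c : A) : Module.Dual ℂ A :=
  ω ∘ₗ LinearMap.mulLeft ℂ c ∘ₗ LinearMap.mulRight ℂ b

/-- The monoid action `a ▷ ω = a · ω · a*`, i.e. `(a ▷ ω) (x) = ω (a* x a)`. -/
def act (a : A) (ω : Module.Dual ℂ A) : Module.Dual ℂ A :=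
  bimul a ω (star a)

end Dual

/-- A quasi-order on the Hermitian elements of a unital complex `*`-algebra that turns it into a
quasi-ordered `*`-algebra. The relation on `A_H` is a relation on `A` which holds only between
Hermitian elements. -/
structure QuasiOrderedStarAlgebra (A : Type*) [Ring A] [StarRing A] [Algebra ℂ A]
    [StarModule ℂ A] where
  le : A → A → Prop
  isSelfAdjoint_of_le : ∀ {a b : A}, le a b → IsSelfAdjoint a ∧ IsSelfAdjoint b
  le_refl : ∀ {a : A}, IsSelfAdjoint a → le a a
  le_trans : ∀ {a b c : A}, le a b → le b c → le a c
  add_le_add : ∀ {a b c : A}, le a b → IsSelfAdjoint c → le (a + c) (b + c)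
  conj_le_conj : ∀ {a b : A} (d : A), le a b → le (star d * a * d) (star d * b * d)
  zero_le_one : le 0 1

namespace QuasiOrderedStarAlgebra

variable {A : Type*} [Ring A] [StarRing A] [Algebra ℂ A] [StarModule ℂ A]
  (𝒜 : QuasiOrderedStarAlgebra A)

/-- The cone of positive elements. -/
def pos : Set A := {a | 𝒜.le 0 a}

/-- The order on Hermitian functionals: `ω ≤ ρ` iff `ω a ≤ ρ a` for all positive `a`. -/
def dualLE (ω ρ : Module.Dual ℂ A) : Prop :=
  ∀ a ∈ 𝒜.pos, ω a ≤ ρ a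

/-- Hermitian functionals which are positive for the order. -/
def posDual : Set (Module.Dual ℂ A) :=
  {ω | ω ∈ hermitianDual A ∧ 𝒜.dualLE 0 ω}

/-- Coercive elements. -/
def Coercive (q : A) : Prop :=
  q ∈ 𝒜.pos ∧ ∃ ε : ℝ, 0 < ε ∧ 𝒜.le ((ε : ℂ) • (1 : A)) q

/-- The dominated subalgebra `Q↓` of a set `Q` of Hermitian elements. -/
def down (Q : Set A) : Set A :=
  {a | ∀ q ∈ Q, ∃ r ∈ Q, ∃ s ∈ Q,
    𝒜.le (star a * q ^ 2 * a) (r ^ 2) ∧ 𝒜.le (a * q ^ 2 * star a) (s ^ 2)}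

end QuasiOrderedStarAlgebra

/-- All `t q₁ ⋯ q_N` with `t ∈ [1, ∞)`, `N ≥ 1` and `q₁, …, q_N ∈ Q'`. -/
def dominantSet {A : Type*} [Ring A] [Algebra ℂ A] (Q' : Set A) : Set A :=
  {x | ∃ (t : ℝ) (l : List A), 1 ≤ t ∧ l ≠ [] ∧ (∀ q ∈ l, q ∈ Q') ∧ x = (t : ℂ) • l.prod}

/-- An abstract `O*`-algebra: a quasi-ordered `*`-algebra `A` together with a linear subspace and
subbimodule `Ω` of the algebraic dual, stable under the involution, spanned by its positive
functionals, and such that the positive functionals in `Ω` determine the order of `A`. -/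
structure AbstractOStarAlgebra (A : Type*) [Ring A] [StarRing A] [Algebra ℂ A]
    [StarModule ℂ A] extends QuasiOrderedStarAlgebra A where
  Ω : Submodule ℂ (Module.Dual ℂ A)
  bimul_mem : ∀ ω ∈ Ω, ∀ b c : A, bimul b ω c ∈ Ω
  dualStar_mem : ∀ ω ∈ Ω, dualStar ω ∈ Ω
  span_eq : Submodule.span ℂ ((Ω : Set (Module.Dual ℂ A)) ∩ toQuasiOrderedStarAlgebra.posDual) = Ω
  pos_eq : toQuasiOrderedStarAlgebra.pos =
    {a | IsSelfAdjoint a ∧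
      ∀ ω ∈ (Ω : Set (Module.Dual ℂ A)) ∩ toQuasiOrderedStarAlgebra.posDual, 0 ≤ ω a}

namespace AbstractOStarAlgebra

variable {A : Type*} [Ring A] [StarRing A] [Algebra ℂ A] [StarModule ℂ A]
  (𝒜 : AbstractOStarAlgebra A)

/-- The cone `Ω⁺_H` of positive linear functionals of `(A, Ω)`. -/
def posΩ : Set (Module.Dual ℂ A) :=
  (𝒜.Ω : Set (Module.Dual ℂ A)) ∩ 𝒜.posDual

/-- The states of `(A, Ω)`. -/
def states : Set (Module.Dual ℂ A) :=
  {ω | ω ∈ 𝒜.posΩ ∧ ω 1 = 1}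

theorem algPositive_of_mem {ω : Module.Dual ℂ A} (hω : ω ∈ 𝒜.posΩ) : AlgPositive ω := by
  intro a
  have h : 𝒜.le (star a * 0 * a) (star a * 1 * a) := 𝒜.conj_le_conj a 𝒜.zero_le_one
  simp only [mul_zero, zero_mul, mul_one] at h
  simpa using hω.2.2 _ h

theorem zero_mem_posΩ : (0 : Module.Dual ℂ A) ∈ 𝒜.posΩ := by
  refine ⟨𝒜.Ω.zero_mem, ?_, fun a _ => le_rfl⟩
  ext a
  simp [dualStar]

instance : Nonempty 𝒜.posΩ := ⟨⟨0, 𝒜.zero_mem_posΩ⟩⟩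

/-- The positive semidefinite form `(a, b) ↦ ω (a* b)`. -/
abbrev gnsCore (ω : 𝒜.posΩ) : PreInnerProductSpace.Core ℂ A where
  inner a b := ω.1 (star a * b)
  conj_inner_symm a b := by
    have h := congrArg (fun f : Module.Dual ℂ A => f (star a * b)) ω.2.2.1
    simpa [dualStar] using h
  re_inner_nonneg a := (Complex.le_def.1 (𝒜.algPositive_of_mem ω.2 a)).1
  add_left a b c := by simp [add_mul]
  smul_left a b c := by simp [star_smul]

/-- The seminorm `a ↦ √(ω (a* a))`. -/
def stSeminorm (ω : 𝒜.posΩ) : Seminorm ℂ A :=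
  letI := 𝒜.gnsCore ω
  Seminorm.of (fun a => Real.sqrt (ω.1 (star a * a)).re)
    (fun a b => by
      let := InnerProductSpace.Core.toSeminormedAddCommGroup (𝕜 := ℂ) (F := A)
      exact norm_add_le a b)
    (fun c a => by
      let := InnerProductSpace.Core.toSeminormedAddCommGroup (𝕜 := ℂ) (F := A)
      let := InnerProductSpace.Core.toNormedSpace (𝕜 := ℂ) (F := A)
      exact norm_smul c a)

/-- The strong topology: the locally convex topology defined by the seminorms
`a ↦ √(ω (a* a))`, where `ω` runs through the positive linear functionals of `(A, Ω)`. -/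
abbrev strongTopology : TopologicalSpace A :=
  (SeminormFamily.moduleFilterBasis (𝕜 := ℂ) (F := A) 𝒜.stSeminorm).topology

/-- `ω` is a Stieltjes state for `a`: for all `b` with `ω (b* b) = 1`, either `(b ▷ ω) a = 0` or
`∑_{n ≥ 1} ((b ▷ ω) (a ^ n)) ^ (-1 / (2 n)) = ∞`. -/
def IsStieltjesState (ω : Module.Dual ℂ A) (a : A) : Prop :=
  ω ∈ 𝒜.states ∧ a ∈ 𝒜.pos ∧
    ∀ b : A, ω (star b * b) = 1 →
      act b ω a = 0 ∨
        ∑' n : ℕ, ENNReal.ofReal (act b ω (a ^ (n + 1))).re ^ (-(1 / (2 * ((n : ℝ) + 1)))) = ∞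

/-- `(A, Ω)` has sufficiently many Stieltjes states. -/
def SufficientlyManyStieltjesStates : Prop :=
  ∃ Q' : Set A, Q'.Nonempty ∧ Q' ⊆ 𝒜.pos ∧ (∀ q ∈ Q', 𝒜.Coercive q) ∧
    (∀ q ∈ Q', ∀ r ∈ Q', Commute q r) ∧
    (∀ ω ∈ 𝒜.states, ∀ q ∈ Q', 𝒜.IsStieltjesState ω q) ∧
    𝒜.pos ⊆ @closure A 𝒜.strongTopology (𝒜.down (dominantSet Q') ∩ 𝒜.pos)

/-- `(A, Ω)` is downwards closed. -/
def DownwardsClosed : Prop :=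
  ∀ ρ ∈ 𝒜.posDual, (∃ ω ∈ 𝒜.posΩ, ω - ρ ∈ 𝒜.posDual) → ρ ∈ 𝒜.posΩ

end AbstractOStarAlgebra

end OStar

end

noncomputable section

namespace OStar

/-! ### Carleman's inequality -/

section Carleman

/-! In the GNS space of `ω`, the form of `ρ` is dominated by the inner product, hence given by a
positive bounded operator `T` (`exists_nonneg_inner_eq`) that commutes weakly with left
multiplication by Hermitian elements. For a positive `a` in the dominated subalgebra there is a
product `r` of elements of `Q'` relative to which `a` is bounded. If `r` has dense range, then `r⁻¹`
and `r⁻¹ a r⁻¹` are bounded operators commuting with `T`, so `T r⁻¹ a r⁻¹` is positive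
(`inner_nonneg_of_weakly_commute`); hence `ρ a ≥ 0`. Strong continuity of `ρ` extends this to all
positive elements. The same argument applies to `ω - ρ`, and downward closedness then puts `ρ` in
`Ω`.

The analytic core is the density of the range of `r` (`denseRange_prod_mul`). A vector orthogonal to
the range of a coercive `q` is a bounded functional killing that range. Passing to a square root of
`q ⊕ q` turns the Stieltjes condition into Carleman's (`eq_zero_of_stieltjes`). Carleman's condition
is handled without measures (`eq_zero_of_carleman`): along the Lanczos vectors, two square-summable
solutions of the recurrence have a Wronskian bounded below, and Carleman's inequality then
contradicts divergence of the series. -/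

theorem sum_weighted_div_sq_le (a : ℕ → ℝ) (ha : ∀ n, 0 ≤ a n) (N : ℕ) :
    ∑ n ∈ Finset.range N, (∑ j ∈ Finset.range (n + 1), ((j : ℝ) + 1) * a j) / ((n : ℝ) + 1) ^ 2 ≤
      2 * ∑ j ∈ Finset.range N, a j - (∑ j ∈ Finset.range N, ((j : ℝ) + 1) * a j) / N := by
  induction N with
  | zero => simp
  | succ N ih =>
    rw [Finset.sum_range_succ, Finset.sum_range_succ a, Finset.sum_range_succ _ N]
    set S := ∑ j ∈ Finset.range N, ((j : ℝ) + 1) * a j with hS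
    have hS0 : 0 ≤ S := Finset.sum_nonneg fun j _ => mul_nonneg (by positivity) (ha j)
    -- The subtracted quotient in the statement is what makes the induction close: `1/(N+1)² ≤ 1/N -
    -- 1/(N+1)`. For `N = 0` both sides vanish.
    have h1 : S / ((N : ℝ) + 1) ^ 2 + S / ((N : ℝ) + 1) ≤ S / N := by
      rcases Nat.eq_zero_or_pos N with rfl | hN
      · simp [hS]
      · have hN' : (0 : ℝ) < N := by exact_mod_cast hN
        rw [← sub_nonneg]
        have : S / N - (S / ((N : ℝ) + 1) ^ 2 + S / ((N : ℝ) + 1)) =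
            S / (N * ((N : ℝ) + 1) ^ 2) := by field_simp; ring
        rw [this]; positivity
    have h2 : ((N : ℝ) + 1) * a N / ((N : ℝ) + 1) ^ 2 + ((N : ℝ) + 1) * a N / ((N : ℝ) + 1) ≤
        2 * a N := by
      have h3 : ((N : ℝ) + 1) * a N / ((N : ℝ) + 1) ^ 2 = a N / ((N : ℝ) + 1) := by field_simp
      have h4 : ((N : ℝ) + 1) * a N / ((N : ℝ) + 1) = a N := by field_simp
      have h5 : a N / ((N : ℝ) + 1) ≤ a N :=
        div_le_self (ha N) (by have : (0 : ℝ) ≤ N := Nat.cast_nonneg N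
                               linarith)
      linarith
    push_cast
    rw [add_div, add_div]
    linarith

/-- A qualitative form of Carleman's inequality: the geometric means of a summable sequence of
nonnegative numbers are summable. -/
theorem summable_geomMean {a : ℕ → ℝ} (ha : ∀ n, 0 ≤ a n) (hs : Summable a) :
    Summable fun n : ℕ => (∏ j ∈ Finset.range (n + 1), a j) ^ (1 / ((n : ℝ) + 1)) := by
  have key : ∀ n : ℕ, (∏ j ∈ Finset.range (n + 1), a j) ^ (1 / ((n : ℝ) + 1)) ≤
      Real.exp 1 * ((∑ j ∈ Finset.range (n + 1), ((j : ℝ) + 1) * a j) / ((n : ℝ) + 1) ^ 2) := by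
    intro n
    have hn : (0 : ℝ) < (n : ℝ) + 1 := by positivity
    have hP : 0 ≤ ∏ j ∈ Finset.range (n + 1), a j := Finset.prod_nonneg fun j _ => ha j
    -- The weights `j + 1` make the sums over `n` converge; they cost a factor `(n+1)!`, whose root
    -- is at least `(n+1)/e`.
    have amgm := Real.geom_mean_le_arith_mean (Finset.range (n + 1)) (fun _ => (1 : ℝ))
      (fun j => ((j : ℝ) + 1) * a j) (fun _ _ => zero_le_one) (by simp; positivity)
      (fun j _ => mul_nonneg (by positivity) (ha j))
    simp only [Real.rpow_one, Finset.sum_const, Finset.card_range, nsmul_eq_mul, mul_one, one_mul,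
      Finset.prod_mul_distrib] at amgm
    have hfac : ∏ j ∈ Finset.range (n + 1), ((j : ℝ) + 1) = ((n + 1).factorial : ℝ) := by
      rw [← Finset.prod_range_add_one_eq_factorial]; push_cast; rfl
    rw [hfac, Real.mul_rpow (by positivity) hP] at amgm
    push_cast at amgm
    have hexp : ((n : ℝ) + 1) / Real.exp 1 ≤
        ((n + 1).factorial : ℝ) ^ (((n : ℝ) + 1)⁻¹) := by
      have h := Real.pow_div_factorial_le_exp ((n : ℝ) + 1) hn.le (n + 1)
      have h' : (((n : ℝ) + 1) / Real.exp 1) ^ (n + 1) ≤ ((n + 1).factorial : ℝ) := by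
        rw [div_pow, ← Real.exp_nat_mul, div_le_iff₀ (Real.exp_pos _)]
        rw [div_le_iff₀ (by positivity)] at h
        push_cast
        rw [mul_one]
        linarith
      have := Real.rpow_le_rpow (by positivity) h' (by positivity : 0 ≤ ((n : ℝ) + 1)⁻¹)
      rw [show ((n : ℝ) + 1)⁻¹ = (((n + 1 : ℕ) : ℝ))⁻¹ by push_cast; rfl] at this ⊢
      rwa [Real.pow_rpow_inv_natCast (by positivity) (by omega)] at this
    rw [one_div]
    set G := (∏ j ∈ Finset.range (n + 1), a j) ^ (((n : ℝ) + 1)⁻¹)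
    have hG : 0 ≤ G := Real.rpow_nonneg hP _
    set S := ∑ j ∈ Finset.range (n + 1), ((j : ℝ) + 1) * a j
    have h1 : ((n : ℝ) + 1) / Real.exp 1 * G ≤ S / ((n : ℝ) + 1) :=
      (mul_le_mul_of_nonneg_right hexp hG).trans amgm
    calc G = Real.exp 1 / ((n : ℝ) + 1) * (((n : ℝ) + 1) / Real.exp 1 * G) := by field_simp
      _ ≤ Real.exp 1 / ((n : ℝ) + 1) * (S / ((n : ℝ) + 1)) :=
        mul_le_mul_of_nonneg_left h1 (by positivity)
      _ = _ := by field_simp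
  have hs' : Summable fun n : ℕ =>
      (∑ j ∈ Finset.range (n + 1), ((j : ℝ) + 1) * a j) / ((n : ℝ) + 1) ^ 2 := by
    refine summable_of_sum_range_le (c := 2 * ∑' n, a n) (fun n => ?_) (fun N => ?_)
    · exact div_nonneg (Finset.sum_nonneg fun j _ => mul_nonneg (by positivity) (ha j))
        (by positivity)
    · have h0 : 0 ≤ (∑ j ∈ Finset.range N, ((j : ℝ) + 1) * a j) / N :=
        div_nonneg (Finset.sum_nonneg fun j _ => mul_nonneg (by positivity) (ha j))
          (by positivity)
      linarith [sum_weighted_div_sq_le a ha N, hs.sum_le_tsum (Finset.range N) fun j _ => ha j]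
  exact Summable.of_nonneg_of_le
    (fun n => Real.rpow_nonneg (Finset.prod_nonneg fun j _ => ha j) _) key (hs'.mul_left _)

end Carleman

/-! ### Lanczos vectors and Carleman's condition -/

section Lanczos

variable {K : Type*} [SeminormedAddCommGroup K] [InnerProductSpace ℂ K]

/-- The unnormalised Lanczos vectors of an operator `X` with starting vector `v`. -/
def lanczos (X : K →ₗ[ℂ] K) (v : K) : ℕ → K
  | 0 => v
  | 1 => X v - (inner ℂ v (X v) / (‖v‖ : ℂ) ^ 2) • v
  | n + 2 => X (lanczos X v (n + 1)) -
      (inner ℂ (lanczos X v (n + 1)) (X (lanczos X v (n + 1))) /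
        (‖lanczos X v (n + 1)‖ : ℂ) ^ 2) • lanczos X v (n + 1) -
      ((‖lanczos X v (n + 1)‖ : ℂ) ^ 2 / (‖lanczos X v n‖ : ℂ) ^ 2) • lanczos X v n

/-- The diagonal coefficients of the three-term recurrence of the Lanczos vectors. -/
def lanczosDiag (X : K →ₗ[ℂ] K) (v : K) (n : ℕ) : ℂ :=
  inner ℂ (lanczos X v n) (X (lanczos X v n)) / (‖lanczos X v n‖ : ℂ) ^ 2

/-- The off-diagonal coefficients of the three-term recurrence of the Lanczos vectors. -/
def lanczosOffDiag (X : K →ₗ[ℂ] K) (v : K) (n : ℕ) : ℂ :=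
  (‖lanczos X v (n + 1)‖ : ℂ) ^ 2 / (‖lanczos X v n‖ : ℂ) ^ 2

variable {X : K →ₗ[ℂ] K} {v : K}

theorem lanczos_zero : lanczos X v 0 = v := by rw [lanczos]

theorem apply_lanczos_zero :
    X (lanczos X v 0) = lanczos X v 1 + lanczosDiag X v 0 • lanczos X v 0 := by
  rw [lanczosDiag, lanczos, lanczos]; abel

theorem apply_lanczos_succ (n : ℕ) :
    X (lanczos X v (n + 1)) = lanczos X v (n + 2) +
      lanczosDiag X v (n + 1) • lanczos X v (n + 1) + lanczosOffDiag X v n • lanczos X v n := by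
  rw [lanczosDiag, lanczosOffDiag, lanczos.eq_3]; abel

theorem inner_eq_zero_of_norm_eq_zero {x : K} (hx : ‖x‖ = 0) (y : K) : inner ℂ x y = 0 := by
  have := norm_inner_le_norm (𝕜 := ℂ) x y
  rw [hx, zero_mul] at this
  exact norm_le_zero_iff.1 this

theorem inner_eq_zero_of_norm_eq_zero' {x : K} (hx : ‖x‖ = 0) (y : K) : inner ℂ y x = 0 := by
  rw [← inner_conj_symm, inner_eq_zero_of_norm_eq_zero hx, map_zero]

theorem inner_self_eq_norm_sq_complex (x : K) : inner ℂ x x = (‖x‖ : ℂ) ^ 2 :=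
  inner_self_eq_norm_sq_to_K x

/-- Symmetry replaces continuity here: `⟨X x, X x⟩ = ⟨x, X (X x)⟩`, and Cauchy–Schwarz kills the
right side. -/
theorem norm_apply_eq_zero_of_isSymmetric (hX : X.IsSymmetric) {x : K} (hx : ‖x‖ = 0) :
    ‖X x‖ = 0 := by
  have h : inner ℂ (X x) (X x) = 0 := by
    rw [hX]; exact inner_eq_zero_of_norm_eq_zero hx _
  rw [inner_self_eq_norm_sq_complex] at h
  exact_mod_cast pow_eq_zero_iff two_ne_zero |>.1 h

/-- After a breakdown the coefficients are quotients by zero, hence zero, and the recurrence just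
applies `X` to a null vector. This lets the identities below hold without nondegeneracy assumptions.
-/
theorem norm_lanczos_succ_eq_zero (hX : X.IsSymmetric) {n : ℕ} (hn : ‖lanczos X v n‖ = 0) :
    ‖lanczos X v (n + 1)‖ = 0 := by
  have hXn := norm_apply_eq_zero_of_isSymmetric hX hn
  cases n with
  | zero =>
    have h : lanczos X v 1 = X (lanczos X v 0) := by
      rw [apply_lanczos_zero, lanczosDiag, hn]; simp
    rw [zero_add, h, hXn]
  | succ n =>
    have h : lanczos X v (n + 2) = X (lanczos X v (n + 1)) := by
      rw [apply_lanczos_succ, lanczosDiag, lanczosOffDiag, hn]; simp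
    rw [h, hXn]

theorem inner_lanczos_apply_self (n : ℕ) :
    inner ℂ (lanczos X v n) (X (lanczos X v n)) =
      lanczosDiag X v n * (‖lanczos X v n‖ : ℂ) ^ 2 := by
  by_cases h : ‖lanczos X v n‖ = 0
  · rw [inner_eq_zero_of_norm_eq_zero h, h]; simp
  · have : (‖lanczos X v n‖ : ℂ) ≠ 0 := by exact_mod_cast h
    rw [lanczosDiag]; field_simp

theorem lanczosOffDiag_mul (hX : X.IsSymmetric) (n : ℕ) :
    lanczosOffDiag X v n * (‖lanczos X v n‖ : ℂ) ^ 2 = (‖lanczos X v (n + 1)‖ : ℂ) ^ 2 := by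
  by_cases h : ‖lanczos X v n‖ = 0
  · rw [norm_lanczos_succ_eq_zero hX h, h]; simp
  · have : (‖lanczos X v n‖ : ℂ) ≠ 0 := by exact_mod_cast h
    rw [lanczosOffDiag]; field_simp

theorem conj_lanczosDiag (hX : X.IsSymmetric) (n : ℕ) :
    star (lanczosDiag X v n) = lanczosDiag X v n := by
  have h := inner_conj_symm (𝕜 := ℂ) (lanczos X v n) (X (lanczos X v n))
  rw [hX] at h
  rw [lanczosDiag, ← starRingEnd_apply, map_div₀, h]
  simp

theorem conj_lanczosOffDiag (n : ℕ) :
    star (lanczosOffDiag X v n) = lanczosOffDiag X v n := by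
  simp [lanczosOffDiag]

theorem inner_lanczos_of_lt (hX : X.IsSymmetric) (n : ℕ) :
    ∀ j < n, inner ℂ (lanczos X v j) (lanczos X v n) = 0 := by
  induction n using Nat.strong_induction_on with
  | _ n ih =>
    intro j hj
    match n, hj with
    | 1, hj =>
      obtain rfl : j = 0 := by omega
      have h := inner_lanczos_apply_self (X := X) (v := v) 0
      rw [apply_lanczos_zero, inner_add_right, inner_smul_right,
        inner_self_eq_norm_sq_complex] at h
      linear_combination h
    | n + 2, hj =>
      -- Moving `X` to the left factor and expanding by the recurrence at level `j` leaves only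
      -- vectors of index at most `j + 1`; so only `j = n + 1` and `j = n` need the chosen
      -- coefficients.
      have hrec : inner ℂ (lanczos X v j) (lanczos X v (n + 2)) =
          inner ℂ (X (lanczos X v j)) (lanczos X v (n + 1)) -
          lanczosDiag X v (n + 1) * inner ℂ (lanczos X v j) (lanczos X v (n + 1)) -
          lanczosOffDiag X v n * inner ℂ (lanczos X v j) (lanczos X v n) := by
        rw [hX, apply_lanczos_succ]
        simp only [inner_add_right, inner_smul_right]
        ring
      rw [hrec]
      have ih1 := ih (n + 1) (by omega)
      rcases (show j = n + 1 ∨ j = n ∨ j < n by omega) with rfl | rfl | hjn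
      · have h0 : inner ℂ (lanczos X v (n + 1)) (lanczos X v n) = 0 := by
          rw [← inner_conj_symm, ih1 n (by omega), map_zero]
        rw [hX, inner_lanczos_apply_self, inner_self_eq_norm_sq_complex, h0]
        ring
      · have h1 : inner ℂ (X (lanczos X v j)) (lanczos X v (j + 1)) =
            (‖lanczos X v (j + 1)‖ : ℂ) ^ 2 := by
          cases j with
          | zero =>
            rw [apply_lanczos_zero, inner_add_left, inner_smul_left, ih1 0 (by omega),
              inner_self_eq_norm_sq_complex]
            simp
          | succ j =>
            rw [apply_lanczos_succ, inner_add_left, inner_add_left, inner_smul_left,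
              inner_smul_left, ih1 (j + 1) (by omega), ih1 j (by omega),
              inner_self_eq_norm_sq_complex]
            simp
        rw [h1, ih1 j (by omega), inner_self_eq_norm_sq_complex, lanczosOffDiag_mul hX]
        ring
      · have h1 : inner ℂ (X (lanczos X v j)) (lanczos X v (n + 1)) = 0 := by
          cases j with
          | zero =>
            rw [apply_lanczos_zero, inner_add_left, inner_smul_left, ih1 0 (by omega),
              ih1 1 (by omega)]
            simp
          | succ j =>
            rw [apply_lanczos_succ, inner_add_left, inner_add_left, inner_smul_left,
              inner_smul_left, ih1 (j + 1) (by omega), ih1 j (by omega), ih1 (j + 2) (by omega)]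
            simp
        rw [h1, ih1 j (by omega), ih n (by omega) j hjn]
        ring

/-- Each application of `X` raises the index by one with leading coefficient `1`, and lower vectors
are orthogonal. -/
theorem inner_lanczos_pow_apply_lanczos (hX : X.IsSymmetric) (n k : ℕ) :
    ∀ j, j + k ≤ n → inner ℂ (lanczos X v n) ((X ^ k) (lanczos X v j)) =
      if j + k = n then (‖lanczos X v n‖ : ℂ) ^ 2 else 0 := by
  induction k with
  | zero =>
    intro j hj
    rw [pow_zero, Module.End.one_apply]
    split_ifs with h
    · rw [show j = n by omega, inner_self_eq_norm_sq_complex]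
    · rw [← inner_conj_symm, inner_lanczos_of_lt hX n j (by omega), map_zero]
  | succ k ih =>
    intro j hj
    rw [pow_succ, Module.End.mul_apply]
    cases j with
    | zero =>
      rw [apply_lanczos_zero, map_add, map_smul, inner_add_right, inner_smul_right,
        ih 1 (by omega), ih 0 (by omega), if_neg (show ¬ (0 + k = n) by omega)]
      simp [add_comm]
    | succ j =>
      rw [apply_lanczos_succ, map_add, map_add, map_smul, map_smul, inner_add_right,
        inner_add_right, inner_smul_right, inner_smul_right,
        ih (j + 2) (by omega), ih (j + 1) (by omega), ih j (by omega),
        if_neg (show ¬ (j + 1 + k = n) by omega), if_neg (show ¬ (j + k = n) by omega)]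
      simp [show j + 2 + k = j + 1 + (k + 1) by omega]

/-- The difference of `X ^ n v` and the `n`-th Lanczos vector is orthogonal to the latter, so
Cauchy–Schwarz suffices. -/
theorem norm_lanczos_le (hX : X.IsSymmetric) (n : ℕ) : ‖lanczos X v n‖ ≤ ‖(X ^ n) v‖ := by
  have h := inner_lanczos_pow_apply_lanczos (v := v) hX n n 0 (by omega)
  rw [if_pos (by omega), lanczos_zero] at h
  have h2 := norm_inner_le_norm (𝕜 := ℂ) (lanczos X v n) ((X ^ n) v)
  rw [h, norm_pow, Complex.norm_real, norm_norm, sq] at h2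
  rcases (norm_nonneg (lanczos X v n)).eq_or_lt with h0 | h0
  · rw [← h0]; positivity
  · exact le_of_mul_le_mul_left h2 h0

/-- Bessel's inequality for a bounded linear functional and the Lanczos vectors. -/
theorem sum_norm_sq_div_norm_lanczos_sq_le (hX : X.IsSymmetric) {F : K →ₗ[ℂ] ℂ} {M : ℝ}
    (hF : ∀ x, ‖F x‖ ≤ M * ‖x‖) (N : ℕ) :
    ∑ n ∈ Finset.range N, ‖F (lanczos X v n)‖ ^ 2 / ‖lanczos X v n‖ ^ 2 ≤ M ^ 2 := by
  set S := ∑ n ∈ Finset.range N, ‖F (lanczos X v n)‖ ^ 2 / ‖lanczos X v n‖ ^ 2 with hS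
  have hS0 : 0 ≤ S := Finset.sum_nonneg fun n _ => by positivity
  -- Coefficients of the projection of the Riesz vector of `F`, so that `F z = ‖z‖² = S` and
  -- boundedness gives `S ≤ M √S`.
  let c : ℕ → ℂ := fun n => star (F (lanczos X v n)) / (‖lanczos X v n‖ : ℂ) ^ 2
  set z := ∑ n ∈ Finset.range N, c n • lanczos X v n with hz
  have hFz : F z = (S : ℂ) := by
    rw [hz, map_sum, hS]
    push_cast
    refine Finset.sum_congr rfl fun n _ => ?_
    rw [map_smul, smul_eq_mul, ← Complex.conj_mul']
    simp only [c, starRingEnd_apply]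
    ring
  have hzz : ‖z‖ ^ 2 = S := by
    have : inner ℂ z z = (S : ℂ) := by
      rw [hz, sum_inner]
      rw [hS]
      push_cast
      refine Finset.sum_congr rfl fun n hn => ?_
      rw [inner_smul_left, inner_sum, Finset.sum_eq_single n]
      · rw [inner_smul_right, inner_self_eq_norm_sq_complex, ← Complex.conj_mul']
        by_cases h0 : ‖lanczos X v n‖ = 0
        · simp [c, h0]
        · have : (‖lanczos X v n‖ : ℂ) ≠ 0 := by exact_mod_cast h0
          simp only [c, map_div₀, ← starRingEnd_apply, Complex.conj_conj, map_pow,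
            Complex.conj_ofReal]
          field_simp
      · intro m _ hmn
        rw [inner_smul_right]
        rcases lt_or_gt_of_ne hmn with h | h
        · rw [← inner_conj_symm, inner_lanczos_of_lt hX n m h]; simp
        · rw [inner_lanczos_of_lt hX m n h]; simp
      · intro h; exact absurd hn h
    rw [inner_self_eq_norm_sq_complex] at this
    exact_mod_cast this
  have h := hF z
  rw [hFz, Complex.norm_real, Real.norm_of_nonneg hS0] at h
  rcases hS0.eq_or_lt with h0 | h0
  · rw [← h0]; positivity
  · have h2 : S * S ≤ M ^ 2 * S := by
      nlinarith [mul_self_le_mul_self hS0 h]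
    exact le_of_mul_le_mul_right h2 h0

theorem summable_norm_sq_div_norm_lanczos_sq (hX : X.IsSymmetric) {F : K →ₗ[ℂ] ℂ} {M : ℝ}
    (hF : ∀ x, ‖F x‖ ≤ M * ‖x‖) :
    Summable fun n => ‖F (lanczos X v n)‖ ^ 2 / ‖lanczos X v n‖ ^ 2 :=
  summable_of_sum_range_le (fun n => by positivity) (sum_norm_sq_div_norm_lanczos_sq_le hX hF)

/-- The Wronskian of two functionals along the Lanczos vectors. -/
def lanczosWronskian (X : K →ₗ[ℂ] K) (v : K) (C D : K →ₗ[ℂ] ℂ) (n : ℕ) : ℂ :=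
  star (C (lanczos X v n)) * D (lanczos X v (n + 1)) -
    star (C (lanczos X v (n + 1))) * D (lanczos X v n)

theorem lanczosWronskian_zero (hX : X.IsSymmetric) {C D : K →ₗ[ℂ] ℂ} (hC : ∀ x, C (X x) = 0)
    (hD : ∀ x, D (X x) = C x) : lanczosWronskian X v C D 0 = (‖C v‖ : ℂ) ^ 2 := by
  have h1 := hC (lanczos X v 0)
  have h2 := hD (lanczos X v 0)
  rw [apply_lanczos_zero, map_add, map_smul, smul_eq_mul] at h1 h2
  have h3 := congrArg star h1
  simp only [star_add, star_mul', conj_lanczosDiag hX, star_zero] at h3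
  rw [lanczosWronskian, ← Complex.conj_mul', starRingEnd_apply]
  simp only [zero_add, lanczos_zero] at *
  linear_combination star (C v) * h2 - D v * h3

/-- The functional `C` solves the homogeneous recurrence and `D` the one with source `C`; the
diagonal terms cancel because the coefficients are real. -/
theorem lanczosWronskian_succ (hX : X.IsSymmetric) {C D : K →ₗ[ℂ] ℂ} (hC : ∀ x, C (X x) = 0)
    (hD : ∀ x, D (X x) = C x) (n : ℕ) :
    lanczosWronskian X v C D (n + 1) =
      (‖C (lanczos X v (n + 1))‖ : ℂ) ^ 2 + lanczosOffDiag X v n * lanczosWronskian X v C D n := by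
  have h1 := hC (lanczos X v (n + 1))
  have h2 := hD (lanczos X v (n + 1))
  simp only [apply_lanczos_succ, map_add, map_smul, smul_eq_mul] at h1 h2
  have h3 := congrArg star h1
  simp only [star_add, star_mul', conj_lanczosDiag hX, conj_lanczosOffDiag, star_zero] at h3
  rw [lanczosWronskian, lanczosWronskian, ← Complex.conj_mul', starRingEnd_apply]
  linear_combination star (C (lanczos X v (n + 1))) * h2 - D (lanczos X v (n + 1)) * h3

/-- Divided by `‖lanczos X v n‖²`, the Wronskian is a growing sum of nonnegative terms when no
breakdown occurs; the bound keeps the initial term. -/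
theorem le_lanczosWronskian (hX : X.IsSymmetric) {C D : K →ₗ[ℂ] ℂ} (hC : ∀ x, C (X x) = 0)
    (hD : ∀ x, D (X x) = C x) (hv : ‖v‖ = 1) (n : ℕ) :
    ‖C v‖ ^ 2 * ‖lanczos X v n‖ ^ 2 ≤ ‖lanczosWronskian X v C D n‖ := by
  have h : ((‖C v‖ ^ 2 * ‖lanczos X v n‖ ^ 2 : ℝ) : ℂ) ≤ lanczosWronskian X v C D n := by
    induction n with
    | zero => rw [lanczosWronskian_zero hX hC hD, lanczos_zero, hv]; simp
    | succ n ih =>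
      rw [lanczosWronskian_succ hX hC hD]
      push_cast at ih ⊢
      rw [← lanczosOffDiag_mul hX]
      have h0 : 0 ≤ lanczosOffDiag X v n := by
        rw [lanczosOffDiag]
        exact_mod_cast (by positivity : 0 ≤ ‖lanczos X v (n + 1)‖ ^ 2 / ‖lanczos X v n‖ ^ 2)
      have h1 := mul_le_mul_of_nonneg_left ih h0
      have h2 : (0 : ℂ) ≤ (‖C (lanczos X v (n + 1))‖ : ℂ) ^ 2 := by
        exact_mod_cast sq_nonneg ‖C (lanczos X v (n + 1))‖
      calc _ = lanczosOffDiag X v n * ((‖C v‖ : ℂ) ^ 2 * (‖lanczos X v n‖ : ℂ) ^ 2) := by ring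
        _ ≤ _ := h1
        _ ≤ _ := le_add_of_nonneg_left h2
  have h' := (Complex.le_def.1 h).1
  rw [Complex.ofReal_re] at h'
  exact h'.trans (Complex.re_le_norm _)

/-- If `X` is symmetric and `∑ ‖X ^ n v‖ ^ (-1 / n) = ∞` (Carleman's condition), then a bounded
functional which vanishes on the range of `X` and factors boundedly through `X` vanishes at `v`. -/
theorem eq_zero_of_carleman (hX : X.IsSymmetric) {C D : K →ₗ[ℂ] ℂ} {M M' : ℝ}
    (hCM : ∀ x, ‖C x‖ ≤ M * ‖x‖) (hDM : ∀ x, ‖D x‖ ≤ M' * ‖x‖)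
    (hC : ∀ x, C (X x) = 0) (hD : ∀ x, D (X x) = C x) (hv : ‖v‖ = 1)
    (hsum : ¬ Summable fun n : ℕ => ‖(X ^ (n + 1)) v‖ ^ (-(1 / ((n : ℝ) + 1)))) : C v = 0 := by
  by_contra hCv
  have hCv' : 0 < ‖C v‖ ^ 2 := by positivity
  have hW := le_lanczosWronskian hX hC hD hv
  have hWle : ∀ n, ‖lanczosWronskian X v C D n‖ ≤ ‖C (lanczos X v n)‖ * ‖D (lanczos X v (n + 1))‖ +
      ‖C (lanczos X v (n + 1))‖ * ‖D (lanczos X v n)‖ := fun n => by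
    refine (norm_sub_le _ _).trans (le_of_eq ?_)
    rw [norm_mul, norm_mul, norm_star, norm_star]
  -- No breakdown: at a first null vector both functionals vanish, contradicting the lower bound on
  -- the preceding Wronskian.
  have hpos : ∀ n, 0 < ‖lanczos X v n‖ := by
    intro n
    induction n with
    | zero => rw [lanczos_zero, hv]; exact one_pos
    | succ n ih =>
      by_contra h
      have h0 : ‖lanczos X v (n + 1)‖ = 0 := le_antisymm (not_lt.1 h) (norm_nonneg _)
      have h1 : ‖C (lanczos X v (n + 1))‖ ≤ 0 := by simpa [h0] using hCM (lanczos X v (n + 1))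
      have h2 : ‖D (lanczos X v (n + 1))‖ ≤ 0 := by simpa [h0] using hDM (lanczos X v (n + 1))
      have h3 := (hW n).trans (hWle n)
      rw [le_antisymm h1 (norm_nonneg _), le_antisymm h2 (norm_nonneg _)] at h3
      have : 0 < ‖C v‖ ^ 2 * ‖lanczos X v n‖ ^ 2 := by positivity
      linarith
  have hsC := summable_norm_sq_div_norm_lanczos_sq (v := v) hX hCM
  have hsD := summable_norm_sq_div_norm_lanczos_sq (v := v) hX hDM
  -- Dividing the Wronskian bound by the two norms bounds the ratio by products of terms that are
  -- square-summable by Bessel.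
  have hs : Summable fun n => ‖lanczos X v n‖ / ‖lanczos X v (n + 1)‖ := by
    have hsum4 := (((hsC.add ((summable_nat_add_iff 1).2 hsC)).add
      (hsD.add ((summable_nat_add_iff 1).2 hsD)))).mul_left (1 / ‖C v‖ ^ 2)
    refine Summable.of_nonneg_of_le (fun n => by positivity) (fun n => ?_) hsum4
    have h0 := hpos n
    have h1 := hpos (n + 1)
    have h3 := (hW n).trans (hWle n)
    set s := ‖lanczos X v n‖
    set t := ‖lanczos X v (n + 1)‖
    set p := ‖C (lanczos X v n)‖
    set p' := ‖C (lanczos X v (n + 1))‖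
    set r := ‖D (lanczos X v n)‖
    set r' := ‖D (lanczos X v (n + 1))‖
    rw [one_div, ← div_eq_inv_mul, le_div_iff₀ hCv']
    have h4 : s / t * ‖C v‖ ^ 2 ≤ (p / s) * (r' / t) + (p' / t) * (r / s) := by
      have : (p / s) * (r' / t) + (p' / t) * (r / s) = (p * r' + p' * r) / (s * t) := by
        field_simp
      rw [this, le_div_iff₀ (by positivity)]
      calc s / t * ‖C v‖ ^ 2 * (s * t) = ‖C v‖ ^ 2 * s ^ 2 := by field_simp
        _ ≤ _ := h3
    simp only [← div_pow]
    nlinarith [sq_nonneg (p / s - r' / t), sq_nonneg (p' / t - r / s), sq_nonneg (p / s),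
      sq_nonneg (p' / t), sq_nonneg (r / s), sq_nonneg (r' / t)]
  -- The product telescopes, so the geometric means of the ratios are the roots of `1 / ‖lanczos X v
  -- (n + 1)‖`, which dominate the Carleman terms.
  have hprod : ∀ n, ∏ j ∈ Finset.range n, ‖lanczos X v j‖ / ‖lanczos X v (j + 1)‖ =
      1 / ‖lanczos X v n‖ := by
    intro n
    induction n with
    | zero => simp [lanczos_zero, hv]
    | succ n ih =>
      have h0 := hpos n
      have h1 := hpos (n + 1)
      rw [Finset.prod_range_succ, ih]
      field_simp
  refine hsum (Summable.of_nonneg_of_le (fun n => by positivity) (fun n => ?_)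
    (summable_geomMean (fun n => by positivity) hs))
  have h1 := hpos (n + 1)
  have h2 := norm_lanczos_le (v := v) hX (n + 1)
  rw [hprod, one_div ‖lanczos X v (n + 1)‖, Real.inv_rpow h1.le, Real.rpow_neg (norm_nonneg _)]
  exact inv_anti₀ (Real.rpow_pos_of_pos h1 _)
    (Real.rpow_le_rpow h1.le h2 (by positivity))

end Lanczos

/-! ### From Stieltjes' condition to Carleman's -/

section Stieltjes

universe u

variable {E : Type u} [AddCommGroup E] [Module ℂ E]

/-- A positive semidefinite form is induced by a linear map with dense range into a Hilbert
space. -/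
theorem exists_denseRange_inner_eq (c : PreInnerProductSpace.Core ℂ E) :
    ∃ (H : Type u) (_ : NormedAddCommGroup H) (_ : InnerProductSpace ℂ H) (_ : CompleteSpace H)
      (π : E →ₗ[ℂ] H), DenseRange π ∧ ∀ x y, inner ℂ (π x) (π y) = c.inner x y := by
  let := @InnerProductSpace.Core.toSeminormedAddCommGroup ℂ E _ _ _ c
  let : InnerProductSpace ℂ E := InnerProductSpace.ofCore c
  refine ⟨UniformSpace.Completion E, inferInstance, inferInstance, inferInstance,
    (UniformSpace.Completion.toComplL (𝕜 := ℂ) (E := E)).toLinearMap, ?_, fun x y => ?_⟩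
  · exact UniformSpace.Completion.denseRange_coe
  · exact UniformSpace.Completion.inner_coe x y

/-- The pullback of the inner product along a linear map. -/
abbrev comapCore {H : Type*} [NormedAddCommGroup H] [InnerProductSpace ℂ H] (f : E →ₗ[ℂ] H) :
    PreInnerProductSpace.Core ℂ E where
  inner x y := inner ℂ (f x) (f y)
  conj_inner_symm x y := inner_conj_symm _ _
  re_inner_nonneg x := inner_self_nonneg
  add_left x y z := by rw [map_add, inner_add_left]
  smul_left x y r := by rw [map_smul, inner_smul_left]

/-- The form `⟨(u, v), (u', v')⟩ = ⟨u, u'⟩ + ⟨v, q v'⟩` on `E × E`. -/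
abbrev doubledCore (c : PreInnerProductSpace.Core ℂ E) (q : E →ₗ[ℂ] E)
    (hq : ∀ x y, c.inner (q x) y = c.inner x (q y)) (hpos : ∀ x, 0 ≤ (c.inner x (q x)).re) :
    PreInnerProductSpace.Core ℂ (E × E) where
  inner x y := c.inner x.1 y.1 + c.inner x.2 (q y.2)
  conj_inner_symm x y := by
    rw [map_add, c.conj_inner_symm, c.conj_inner_symm, hq]
  re_inner_nonneg x := by
    rw [map_add]
    exact add_nonneg (c.re_inner_nonneg _) (hpos _)
  add_left x y z := by
    simp only [Prod.fst_add, Prod.snd_add, c.add_left]; ring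
  smul_left x y r := by
    simp only [Prod.smul_fst, Prod.smul_snd, c.smul_left]; ring

/-- A square root of `q ⊕ q` on `E × E`. -/
def doubledSqrt (q : E →ₗ[ℂ] E) : E × E →ₗ[ℂ] E × E :=
  (q ∘ₗ LinearMap.snd ℂ E E).prod (LinearMap.fst ℂ E E)

theorem doubledSqrt_apply (q : E →ₗ[ℂ] E) (x : E × E) : doubledSqrt q x = (q x.2, x.1) := rfl

theorem doubledSqrt_pow_two_mul (q : E →ₗ[ℂ] E) (n : ℕ) (x : E × E) :
    (doubledSqrt q ^ (2 * n)) x = ((q ^ n) x.1, (q ^ n) x.2) := by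
  induction n generalizing x with
  | zero => simp
  | succ n ih =>
    rw [show 2 * (n + 1) = 2 * n + 1 + 1 by ring, pow_succ, pow_succ, Module.End.mul_apply,
      Module.End.mul_apply, doubledSqrt_apply, doubledSqrt_apply, ih, pow_succ,
      Module.End.mul_apply, Module.End.mul_apply]

/-- If `q` is symmetric and bounded below by `ε > 0` and `b` is a Stieltjes vector for `q`, then a
bounded functional which vanishes on the range of `q` vanishes at `b`. -/
theorem eq_zero_of_stieltjes (c : PreInnerProductSpace.Core ℂ E) (q : E →ₗ[ℂ] E)
    (hq : ∀ x y, c.inner (q x) y = c.inner x (q y)) {ε : ℝ} (hε : 0 < ε)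
    (hpos : ∀ x, ε * (c.inner x x).re ≤ (c.inner x (q x)).re) {C : E →ₗ[ℂ] ℂ} {M : ℝ}
    (hCM : ∀ x, ‖C x‖ ^ 2 ≤ M ^ 2 * (c.inner x x).re) (hCq : ∀ x, C (q x) = 0) {b : E}
    (hb : c.inner b b = 1)
    (hS : ∑' n : ℕ, ENNReal.ofReal (c.inner b ((q ^ (n + 1)) b)).re ^
      (-(1 / (2 * ((n : ℝ) + 1)))) = ∞) : C b = 0 := by
  have hcpos : ∀ x, 0 ≤ (c.inner x x).re := c.re_inner_nonneg
  have hqpos : ∀ x, 0 ≤ (c.inner x (q x)).re := fun x =>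
    (mul_nonneg hε.le (hcpos x)).trans (hpos x)
  let k := doubledCore c q hq hqpos
  let := @InnerProductSpace.Core.toSeminormedAddCommGroup ℂ (E × E) _ _ _ k
  let : InnerProductSpace ℂ (E × E) := InnerProductSpace.ofCore k
  have hin : ∀ x y : E × E, inner ℂ x y = c.inner x.1 y.1 + c.inner x.2 (q y.2) :=
    fun x y => rfl
  have hnorm : ∀ x : E × E, ‖x‖ ^ 2 = (c.inner x.1 x.1).re + (c.inner x.2 (q x.2)).re := by
    intro x
    rw [← inner_self_eq_norm_sq (𝕜 := ℂ), hin, map_add]; rfl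
  set X := doubledSqrt q with hXdef
  have hX : X.IsSymmetric := by
    intro x y
    rw [hin, hin, hXdef, doubledSqrt_apply, doubledSqrt_apply]
    simp only [hq]
    ring
  have bound : ∀ (F : E × E →ₗ[ℂ] ℂ) (R : ℝ), 0 ≤ R → (∀ x, ‖F x‖ ^ 2 ≤ R ^ 2 * ‖x‖ ^ 2) →
      ∀ x, ‖F x‖ ≤ R * ‖x‖ := fun F R hR h x => by
    have := h x
    rw [← mul_pow] at this
    exact (pow_le_pow_iff_left₀ (norm_nonneg _) (by positivity) two_ne_zero).1 this
  have h0 : ∀ y, c.inner 0 y = 0 := fun y => by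
    have := c.add_left 0 0 y
    rw [add_zero] at this
    exact left_eq_add.1 this
  -- Needed to keep all `X ^ n (b, 0)` non-null: a negative power of zero is `∞` in `ENNReal` but
  -- `0` in `ℝ`.
  have hXinj : ∀ x, ‖X x‖ = 0 → ‖x‖ = 0 := by
    rintro ⟨x, y⟩ hx
    have hy := inner_eq_zero_of_norm_eq_zero' hx ((y, 0) : E × E)
    have hx2 := hnorm (X (x, y))
    rw [hx] at hx2
    simp only [hXdef, doubledSqrt_apply, hin, h0, add_zero] at hy hx2
    rw [← sq_eq_zero_iff, hnorm]
    simp only [hy, Complex.zero_re, add_zero]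
    have h3 := hpos x
    have h4 := hcpos (q y)
    have h5 := mul_nonneg hε.le (hcpos x)
    have h6 : ε * (c.inner x x).re = 0 := by linarith
    simpa [hε.ne'] using h6
  have h1 : ∀ x, ‖(C ∘ₗ LinearMap.fst ℂ E E) x‖ ≤ |M| * ‖x‖ := by
    refine bound _ _ (abs_nonneg _) fun x => ?_
    rw [sq_abs, hnorm]
    refine (hCM x.1).trans (mul_le_mul_of_nonneg_left ?_ (sq_nonneg _))
    linarith [hqpos x.2]
  -- Here the lower bound `ε` enters: the second coordinate is measured by `⟨y, q y⟩ ≥ ε ⟨y, y⟩`.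
  have h2 : ∀ x, ‖(C ∘ₗ LinearMap.snd ℂ E E) x‖ ≤ Real.sqrt (M ^ 2 / ε) * ‖x‖ := by
    refine bound _ _ (Real.sqrt_nonneg _) fun x => ?_
    rw [Real.sq_sqrt (by positivity), hnorm, div_mul_eq_mul_div, le_div_iff₀ hε]
    have := hCM x.2
    simp only [LinearMap.comp_apply, LinearMap.snd_apply]
    calc _ ≤ M ^ 2 * (c.inner x.2 x.2).re * ε := mul_le_mul_of_nonneg_right this hε.le
      _ = M ^ 2 * (ε * (c.inner x.2 x.2).re) := by ring
      _ ≤ _ := mul_le_mul_of_nonneg_left (by linarith [hcpos x.1, hpos x.2]) (sq_nonneg _)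
  have hv : ‖((b, 0) : E × E)‖ = 1 := by
    have h := hnorm (b, 0)
    simp only [hb, h0, Complex.one_re, Complex.zero_re, add_zero] at h
    exact (pow_eq_one_iff_of_nonneg (norm_nonneg _) two_ne_zero).1 h
  have hXpow : ∀ n, ‖(X ^ n) (b, (0 : E))‖ ≠ 0 := by
    intro n
    induction n with
    | zero => rw [pow_zero, Module.End.one_apply, hv]; exact one_ne_zero
    | succ n ih =>
      rw [pow_succ', Module.End.mul_apply]
      exact fun h => ih (hXinj _ h)
  have key := eq_zero_of_carleman (X := X) (v := (b, 0)) hX h1 h2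
    (fun x => by simpa [hXdef, doubledSqrt_apply] using hCq x.2)
    (fun x => by simp [hXdef, doubledSqrt_apply]) hv ?_
  · simpa using key
  · intro hs
    have hterm : ∀ n : ℕ, ENNReal.ofReal (c.inner b ((q ^ (n + 1)) b)).re ^
        (-(1 / (2 * ((n : ℝ) + 1)))) ≤
        ENNReal.ofReal (‖(X ^ (n + 1)) (b, (0 : E))‖ ^ (-(1 / ((n : ℝ) + 1)))) := by
      intro n
      have hne : 0 < ‖(X ^ (n + 1)) (b, (0 : E))‖ :=
        (norm_nonneg _).lt_of_ne' (hXpow (n + 1))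
      have hsq : (c.inner b ((q ^ (n + 1)) b)).re = ‖(X ^ (n + 1)) (b, (0 : E))‖ ^ 2 := by
        rw [← inner_self_eq_norm_sq (𝕜 := ℂ), hX.pow, ← Module.End.mul_apply, ← pow_add,
          ← two_mul, hXdef, doubledSqrt_pow_two_mul, hin]
        simp [h0]
      rw [hsq, ENNReal.ofReal_rpow_of_pos (by positivity)]
      refine le_of_eq (congrArg _ ?_)
      rw [← Real.rpow_natCast, ← Real.rpow_mul hne.le]
      congr 1
      push_cast
      field_simp
    have := ENNReal.tsum_le_tsum hterm
    rw [hS, ← ENNReal.ofReal_tsum_of_nonneg (fun n => by positivity) hs] at this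
    exact ENNReal.ofReal_ne_top (top_le_iff.1 this)

end Stieltjes

/-! ### Positive operators and weak commutation -/

section Hilbert

open scoped InnerProductSpace

variable {H : Type*} [NormedAddCommGroup H] [InnerProductSpace ℂ H]

theorem ext_of_denseRange_inner {E : Type*} {f : E → H} (hf : DenseRange f) {S T : H →L[ℂ] H}
    (h : ∀ x y, inner ℂ (S (f x)) (f y) = inner ℂ (T (f x)) (f y)) : S = T := by
  refine DFunLike.coe_injective (hf.equalizer S.continuous T.continuous (funext fun x => ?_))
  refine ext_inner_right ℂ fun z => ?_
  refine congrFun (hf.equalizer (g := fun z => inner ℂ (S (f x)) z)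
    (h := fun z => inner ℂ (T (f x)) z) (by fun_prop) (by fun_prop) (funext fun y => ?_)) z
  exact h x y

variable {E : Type*} [AddCommGroup E] [Module ℂ E] [CompleteSpace H]

/-- A positive semidefinite form dominated by the inner product is given by a positive operator. -/
theorem exists_nonneg_inner_eq {π : E →ₗ[ℂ] H} (hπ : DenseRange π)
    (c : PreInnerProductSpace.Core ℂ E) (hc : ∀ x, (c.inner x x).re ≤ ‖π x‖ ^ 2) :
    ∃ T : H →L[ℂ] H, 0 ≤ T ∧ ∀ x y, inner ℂ (T (π x)) (π y) = c.inner x y := by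
  obtain ⟨H', _, _, _, π', -, hin⟩ := exists_denseRange_inner_eq c
  have hbound : ∀ x, ‖π' x‖ ≤ 1 * ‖π x‖ := fun x => by
    rw [one_mul, ← pow_le_pow_iff_left₀ (norm_nonneg _) (norm_nonneg _) two_ne_zero,
      ← inner_self_eq_norm_sq (𝕜 := ℂ), hin]
    exact hc x
  let J : H →L[ℂ] H' := π'.extendOfNorm π
  have hJ : ∀ x, J (π x) = π' x := LinearMap.extendOfNorm_eq hπ ⟨1, hbound⟩
  refine ⟨J.adjoint ∘L J, ?_, fun x y => ?_⟩
  · rw [ContinuousLinearMap.nonneg_iff_isPositive]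
    exact ContinuousLinearMap.isPositive_adjoint_comp_self J
  · rw [ContinuousLinearMap.comp_apply, ContinuousLinearMap.adjoint_inner_left, hJ, hJ, hin]

/-- Let `p = π ∘ r` and `g = π ∘ a` for symmetric `r`, `a`, where `r` is bounded below and has dense
range and `a` is positive and `r`-bounded. If the positive operator `T` commutes weakly with `r`
and `a`, then `⟨T x, a x⟩ ≥ 0`. -/
theorem inner_nonneg_of_weakly_commute {π p g : E →ₗ[ℂ] H} (hp : DenseRange p) {M M' : ℝ}
    (hM : ∀ x, ‖π x‖ ≤ M * ‖p x‖) (hM' : ∀ x, ‖g x‖ ≤ M' * ‖p x‖)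
    (hsymm : ∀ x y, inner ℂ (π x) (p y) = inner ℂ (p x) (π y))
    (hg : ∀ x, 0 ≤ inner ℂ (g x) (π x)) {T : H →L[ℂ] H} (hT : 0 ≤ T)
    (hTp : ∀ x y, inner ℂ (T (π x)) (p y) = inner ℂ (T (p x)) (π y))
    (hTg : ∀ x y, inner ℂ (T (π x)) (g y) = inner ℂ (T (g x)) (π y)) (x : E) :
    0 ≤ inner ℂ (T (π x)) (g x) := by
  -- `S` plays the role of `r⁻¹` and `B` of `a r⁻¹`; `S * B` is then `r⁻¹ a r⁻¹`.
  let S : H →L[ℂ] H := π.extendOfNorm p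
  let B : H →L[ℂ] H := g.extendOfNorm p
  have hS : ∀ x, S (p x) = π x := LinearMap.extendOfNorm_eq hp ⟨M, hM⟩
  have hB : ∀ x, B (p x) = g x := LinearMap.extendOfNorm_eq hp ⟨M', hM'⟩
  have hSadj : S.adjoint = S := ext_of_denseRange_inner hp fun x y => by
    rw [ContinuousLinearMap.adjoint_inner_left, hS, hS, hsymm]
  have hSs : ∀ x y, inner ℂ (S x) y = inner ℂ x (S y) := fun x y => by
    rw [← ContinuousLinearMap.adjoint_inner_right, hSadj]
  have hTs : ∀ x y, inner ℂ (T x) y = inner ℂ x (T y) :=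
    ((ContinuousLinearMap.nonneg_iff_isPositive T).1 hT).isSymmetric
  have hmul : ∀ (U V : H →L[ℂ] H) z, (U * V) z = U (V z) := fun _ _ _ => rfl
  have hP : 0 ≤ S * B := by
    rw [ContinuousLinearMap.nonneg_iff_isPositive, ContinuousLinearMap.isPositive_iff_complex]
    intro y
    have h : 0 ≤ inner ℂ ((S * B) y) y := by
      refine hp.induction_on (p := fun y => 0 ≤ inner ℂ ((S * B) y) y) y
        (isClosed_le continuous_const (by fun_prop)) fun x => ?_
      rw [hmul, hB, hSs, hS]
      exact hg x
    exact ⟨Complex.ext rfl (Complex.le_def.1 h).2, (Complex.le_def.1 h).1⟩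
  have hPs : ∀ x y, inner ℂ ((S * B) x) y = inner ℂ x ((S * B) y) :=
    ((ContinuousLinearMap.nonneg_iff_isPositive _).1 hP).isSymmetric
  have hTS : T * S = S * T := ext_of_denseRange_inner hp fun x y => by
    rw [hmul, hmul, hSs, hS, hS, hTp]
  have hTS' : ∀ z, T (S z) = S (T z) := fun z => congrFun (congrArg DFunLike.coe hTS) z
  have hTP : Commute T (S * B) := ext_of_denseRange_inner hp fun x y => by
    rw [hmul T, hmul (S * B), hPs, hmul, hmul, hB, hB, hTS', hSs, hS, ← hTg, ← hSs, ← hTS', hS]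
  -- A product of commuting positive operators is positive; evaluating it at `p x` undoes both
  -- inverses.
  have hTP0 : 0 ≤ T * (S * B) := hTP.mul_nonneg hT hP
  have h := ((ContinuousLinearMap.nonneg_iff_isPositive _).1 hTP0).inner_nonneg_right (p x)
  rw [hmul, ← hTs, hmul, hB, ← hSs, ← hTS', hS] at h
  exact h

end Hilbert

/-! ### Hermitian and algebraically positive functionals -/

section Functionals

theorem isSelfAdjoint_list_prod {A : Type*} [Ring A] [StarRing A] (l : List A)
    (hl : ∀ q ∈ l, IsSelfAdjoint q)
    (hcomm : ∀ q ∈ l, ∀ r ∈ l, Commute q r) : IsSelfAdjoint l.prod := by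
  induction l with
  | nil => exact IsSelfAdjoint.one A
  | cons q l ih =>
    rw [List.prod_cons]
    have h := ih (fun r hr => hl r (List.mem_cons_of_mem _ hr)) fun r hr s hs =>
      hcomm r (List.mem_cons_of_mem _ hr) s (List.mem_cons_of_mem _ hs)
    exact ((hl q List.mem_cons_self).commute_iff h).1
      (Commute.list_prod_right _ _ fun r hr =>
        hcomm q List.mem_cons_self r (List.mem_cons_of_mem _ hr))

variable {A : Type*} [Ring A] [StarRing A] [Algebra ℂ A]

theorem act_apply (b : A) (ω : Module.Dual ℂ A) (x : A) :
    act b ω x = ω (star b * x * b) := by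
  simp [act, bimul, mul_assoc]

variable [StarModule ℂ A]

theorem apply_star_of_mem_hermitianDual {ω : Module.Dual ℂ A} (hω : ω ∈ hermitianDual A) (x : A) :
    ω (star x) = star (ω x) := by
  have h := congrArg (fun f : Module.Dual ℂ A => f (star x)) hω
  simpa [dualStar] using h.symm

theorem sub_mem_hermitianDual {ω ρ : Module.Dual ℂ A} (hω : ω ∈ hermitianDual A)
    (hρ : ρ ∈ hermitianDual A) : ω - ρ ∈ hermitianDual A := by
  refine LinearMap.ext fun a => ?_
  simp [dualStar, apply_star_of_mem_hermitianDual hω, apply_star_of_mem_hermitianDual hρ]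

/-- The positive semidefinite form `(a, b) ↦ ρ (a* b)` of an algebraically positive functional. -/
abbrev algPositiveCore (ρ : Module.Dual ℂ A) (hρH : ρ ∈ hermitianDual A) (hρ : AlgPositive ρ) :
    PreInnerProductSpace.Core ℂ A where
  inner a b := ρ (star a * b)
  conj_inner_symm a b := by
    have h := apply_star_of_mem_hermitianDual hρH (star b * a)
    rw [star_mul, star_star] at h
    rw [h, starRingEnd_apply]
  re_inner_nonneg a := (Complex.le_def.1 (hρ a)).1
  add_left a b c := by simp [add_mul]
  smul_left a b c := by simp [star_smul]

/-- Cauchy–Schwarz against the cyclic vector `π 1`. -/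
theorem norm_apply_sq_le {ρ : Module.Dual ℂ A} (hρH : ρ ∈ hermitianDual A) (hρ : AlgPositive ρ)
    (a : A) : ‖ρ a‖ ^ 2 ≤ (ρ 1).re * (ρ (star a * a)).re := by
  obtain ⟨H, _, _, _, π, -, hin⟩ := exists_denseRange_inner_eq (algPositiveCore ρ hρH hρ)
  replace hin : ∀ x y, inner ℂ (π x) (π y) = ρ (star x * y) := hin
  have hn : ∀ x, ‖π x‖ ^ 2 = (ρ (star x * x)).re := fun x => by
    rw [← inner_self_eq_norm_sq (𝕜 := ℂ), hin]; rfl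
  have h := norm_inner_le_norm (𝕜 := ℂ) (π 1) (π a)
  rw [hin] at h
  have h' := pow_le_pow_left₀ (norm_nonneg _) h 2
  rw [mul_pow, hn, hn] at h'
  simpa using h'

end Functionals

/-! ### Coercive elements and dense ranges in GNS spaces -/

namespace AbstractOStarAlgebra

variable {A : Type*} [Ring A] [StarRing A] [Algebra ℂ A] [StarModule ℂ A]
  {𝒜 : AbstractOStarAlgebra A}

theorem isSelfAdjoint_of_mem_pos {a : A} (ha : a ∈ 𝒜.pos) : IsSelfAdjoint a :=
  (𝒜.isSelfAdjoint_of_le ha).2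

theorem apply_nonneg {ω : Module.Dual ℂ A} (hω : ω ∈ 𝒜.posΩ) {a : A} (ha : a ∈ 𝒜.pos) :
    0 ≤ ω a := hω.2.2 a ha

theorem apply_le_apply {ω : Module.Dual ℂ A} (hω : ω ∈ 𝒜.posΩ) {a b : A} (hab : 𝒜.le a b) :
    ω a ≤ ω b := by
  have h := 𝒜.add_le_add hab (𝒜.isSelfAdjoint_of_le hab).1.neg
  rw [add_neg_cancel, ← sub_eq_add_neg] at h
  have h2 := apply_nonneg hω h
  rwa [map_sub, sub_nonneg] at h2

theorem conj_mem_pos {a : A} (ha : a ∈ 𝒜.pos) (d : A) : star d * a * d ∈ 𝒜.pos := by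
  have h := 𝒜.conj_le_conj d ha
  rw [mul_zero, zero_mul] at h
  exact h

theorem apply_conj_le {ω : Module.Dual ℂ A} (hω : ω ∈ 𝒜.posΩ) {a b : A} (hab : 𝒜.le a b) (d : A) :
    ω (star d * a * d) ≤ ω (star d * b * d) :=
  apply_le_apply hω (𝒜.conj_le_conj d hab)

theorem smul_mem_posΩ {ω : Module.Dual ℂ A} (hω : ω ∈ 𝒜.posΩ) {t : ℝ} (ht : 0 ≤ t) :
    (t : ℂ) • ω ∈ 𝒜.posΩ := by
  refine ⟨𝒜.Ω.smul_mem _ hω.1, LinearMap.ext fun a => ?_, fun a ha => ?_⟩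
  · simp [dualStar, apply_star_of_mem_hermitianDual hω.2.1]
  · have ht' : (0 : ℂ) ≤ (t : ℂ) := by exact_mod_cast ht
    simpa using mul_nonneg ht' (apply_nonneg hω ha)

theorem apply_one_eq_re {ω : Module.Dual ℂ A} (hω : ω ∈ 𝒜.posΩ) :
    0 ≤ (ω 1).re ∧ ((ω 1).re : ℂ) = ω 1 := by
  have h := Complex.le_def.1 (apply_nonneg hω 𝒜.zero_le_one)
  exact ⟨h.1, Complex.ext rfl h.2⟩

/-- Replacing `ω` by `ω / ω 1` and `b` by `√(ω 1) b` reduces to states, and coercivity rules out the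
degenerate alternative in the definition. -/
theorem stieltjes_of_mem_posΩ {q : A} (hq : 𝒜.Coercive q)
    (hst : ∀ σ ∈ 𝒜.states, 𝒜.IsStieltjesState σ q) {ω : Module.Dual ℂ A} (hω : ω ∈ 𝒜.posΩ)
    {b : A} (hb : ω (star b * b) = 1) :
    ∑' n : ℕ, ENNReal.ofReal (ω (star b * (q ^ (n + 1) * b))).re ^
      (-(1 / (2 * ((n : ℝ) + 1)))) = ∞ := by
  obtain ⟨ht, htω⟩ := apply_one_eq_re hω
  set t := (ω 1).re with htdef
  have ht0 : t ≠ 0 := by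
    intro h0
    have h := norm_apply_sq_le hω.2.1 (𝒜.algPositive_of_mem hω) (star b * b)
    rw [hb, ← htdef, h0] at h
    norm_num at h
  have htpos : 0 < t := lt_of_le_of_ne ht ht0.symm
  set σ : Module.Dual ℂ A := ((t⁻¹ : ℝ) : ℂ) • ω with hσ
  have hσs : σ ∈ 𝒜.states := by
    refine ⟨smul_mem_posΩ hω (by positivity), ?_⟩
    rw [hσ, LinearMap.smul_apply, ← htω, smul_eq_mul]
    push_cast
    exact inv_mul_cancel₀ (by exact_mod_cast ht0)
  set s : ℂ := ((Real.sqrt t : ℝ) : ℂ) with hs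
  have hss : s * s = t := by rw [hs]; exact_mod_cast Real.mul_self_sqrt ht
  have hact : ∀ x, σ (star (s • b) * x * (s • b)) = ω (star b * x * b) := by
    intro x
    have hstar : star s = s := by simp [hs]
    rw [star_smul, hstar, smul_mul_assoc, smul_mul_assoc, mul_smul_comm, smul_smul, hss, hσ,
      LinearMap.smul_apply, map_smul, smul_eq_mul, smul_eq_mul, ← mul_assoc]
    push_cast
    rw [inv_mul_cancel₀ (by exact_mod_cast ht0), one_mul]
  have h1 : σ (star (s • b) * (s • b)) = 1 := by
    have := hact 1
    rw [mul_one, mul_one] at this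
    rw [this, hb]
  rcases (hst σ hσs).2.2 _ h1 with h | h
  · exfalso
    obtain ⟨-, ε, hε, hle⟩ := hq
    have h2 := apply_conj_le hω hle b
    rw [act_apply, hact] at h
    rw [h, mul_smul_comm, mul_one, smul_mul_assoc, map_smul, hb, smul_eq_mul, mul_one] at h2
    have : ε ≤ 0 := by exact_mod_cast h2
    linarith
  · simp only [act_apply, hact] at h
    simpa only [mul_assoc] using h

section GNS

variable {ω : Module.Dual ℂ A} {H : Type*} [NormedAddCommGroup H] [InnerProductSpace ℂ H]
  {π : A →ₗ[ℂ] H}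

theorem exists_le_re_inner_of_coercive (hω : ω ∈ 𝒜.posΩ)
    (hin : ∀ x y, inner ℂ (π x) (π y) = ω (star x * y)) {q : A} (hq : 𝒜.Coercive q) :
    ∃ ε : ℝ, 0 < ε ∧ ∀ x, ε * ‖π x‖ ^ 2 ≤ (inner ℂ (π x) (π (q * x))).re := by
  obtain ⟨-, ε, hε, hle⟩ := hq
  refine ⟨ε, hε, fun x => ?_⟩
  have h := (Complex.le_def.1 (apply_conj_le hω hle x)).1
  rw [mul_smul_comm, mul_one, smul_mul_assoc, map_smul, smul_eq_mul, Complex.re_ofReal_mul,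
    mul_assoc (star x) q] at h
  rw [hin, ← inner_self_eq_norm_sq (𝕜 := ℂ), hin]
  exact h

theorem exists_norm_le_of_coercive (hω : ω ∈ 𝒜.posΩ)
    (hin : ∀ x y, inner ℂ (π x) (π y) = ω (star x * y)) {q : A} (hq : 𝒜.Coercive q) :
    ∃ M : ℝ, 0 ≤ M ∧ ∀ x, ‖π x‖ ≤ M * ‖π (q * x)‖ := by
  obtain ⟨ε, hε, h⟩ := exists_le_re_inner_of_coercive hω hin hq
  refine ⟨ε⁻¹, by positivity, fun x => ?_⟩
  have h1 : ε * ‖π x‖ ^ 2 ≤ ‖π x‖ * ‖π (q * x)‖ :=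
    (h x).trans ((Complex.re_le_norm _).trans (norm_inner_le_norm _ _))
  rw [← div_eq_inv_mul, le_div_iff₀ hε]
  rcases (norm_nonneg (π x)).eq_or_lt with h0 | h0
  · rw [← h0, zero_mul]; exact norm_nonneg _
  · refine le_of_mul_le_mul_left ?_ h0
    linarith

/-- Lower norm bounds compose factor by factor, so coercivity of the product is not needed. -/
theorem exists_norm_le_prod (hω : ω ∈ 𝒜.posΩ)
    (hin : ∀ x y, inner ℂ (π x) (π y) = ω (star x * y)) (l : List A)
    (hl : ∀ q ∈ l, 𝒜.Coercive q) :
    ∃ M : ℝ, 0 ≤ M ∧ ∀ x, ‖π x‖ ≤ M * ‖π (l.prod * x)‖ := by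
  induction l with
  | nil => exact ⟨1, zero_le_one, fun x => by simp⟩
  | cons q l ih =>
    obtain ⟨M, hM0, hM⟩ := ih fun r hr => hl r (List.mem_cons_of_mem _ hr)
    obtain ⟨M', hM0', hM'⟩ := exists_norm_le_of_coercive hω hin (hl q List.mem_cons_self)
    refine ⟨M * M', mul_nonneg hM0 hM0', fun x => ?_⟩
    rw [List.prod_cons, mul_assoc q, mul_assoc M]
    exact (hM x).trans (mul_le_mul_of_nonneg_left (hM' _) hM0)

/-- Commuting coercive elements for which all states are Stieltjes states have products with dense
range in every cyclic representation. -/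
theorem denseRange_prod_mul [CompleteSpace H] (hω : ω ∈ 𝒜.posΩ) (hπ : DenseRange π)
    (hin : ∀ x y, inner ℂ (π x) (π y) = ω (star x * y)) (l : List A)
    (hl : ∀ q ∈ l, 𝒜.Coercive q) (hcomm : ∀ q ∈ l, ∀ r ∈ l, Commute q r)
    (hst : ∀ σ ∈ 𝒜.states, ∀ q ∈ l, 𝒜.IsStieltjesState σ q) :
    DenseRange fun x => π (l.prod * x) := by
  induction l with
  | nil => simpa using hπ
  | cons q l ih =>
    have hsub : ∀ r ∈ l, r ∈ q :: l := fun r hr => List.mem_cons_of_mem _ hr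
    have hdense := ih (fun r hr => hl r (hsub r hr))
      (fun r hr s hs => hcomm r (hsub r hr) s (hsub s hs))
      (fun σ hσ r hr => hst σ hσ r (hsub r hr))
    have hqmem : q ∈ q :: l := List.mem_cons_self
    have hq := hl q hqmem
    have hqs : star q = q := isSelfAdjoint_of_mem_pos hq.1
    have hql : Commute q l.prod := Commute.list_prod_right _ _ fun r hr =>
      hcomm q hqmem r (hsub r hr)
    obtain ⟨ε, hε, hlow⟩ := exists_le_re_inner_of_coercive hω hin hq
    -- The new factor `q` acts on the form pulled back along `p`; commutation makes its powers act
    -- on the vectors `π (l.prod * x)`.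
    let p : A →ₗ[ℂ] H := π ∘ₗ LinearMap.mulLeft ℂ l.prod
    have hp : ∀ x, p x = π (l.prod * x) := fun x => rfl
    have hpq : ∀ x, p (q * x) = π (q * (l.prod * x)) := fun x => by
      rw [hp, ← mul_assoc, ← mul_assoc, hql.eq]
    have hpqn : ∀ n x, p ((LinearMap.mulLeft ℂ q ^ n) x) = π (q ^ n * (l.prod * x)) := by
      intro n x
      rw [LinearMap.pow_mulLeft, LinearMap.mulLeft_apply, hp, ← mul_assoc, ← mul_assoc,
        (hql.pow_left n).eq]
    have hre : ∀ x : A, (inner ℂ (p x) (p x)).re = ‖p x‖ ^ 2 := fun x =>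
      inner_self_eq_norm_sq (𝕜 := ℂ) (p x)
    suffices h : (LinearMap.range (p ∘ₗ LinearMap.mulLeft ℂ q)).topologicalClosure = ⊤ by
      have h2 : DenseRange (p ∘ₗ LinearMap.mulLeft ℂ q) := by
        rw [DenseRange, ← LinearMap.coe_range]
        exact Submodule.dense_iff_topologicalClosure_eq_top.2 h
      convert h2 using 2 with x
      rw [LinearMap.comp_apply, LinearMap.mulLeft_apply, hpq, List.prod_cons, mul_assoc]
    rw [Submodule.topologicalClosure_eq_top_iff, Submodule.eq_bot_iff]
    intro η hη
    have hη0 : ∀ x, inner ℂ η (p (q * x)) = 0 := fun x =>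
      (Submodule.mem_orthogonal' _ _).1 hη _ ⟨x, rfl⟩
    let C : A →ₗ[ℂ] ℂ := (innerSL ℂ η).toLinearMap ∘ₗ p
    have hC : ∀ b, inner ℂ (p b) (p b) = 1 → C b = 0 := by
      intro b hb
      refine eq_zero_of_stieltjes (comapCore p) (LinearMap.mulLeft ℂ q) ?_ hε ?_ (M := ‖η‖) ?_ ?_
        hb ?_
      · intro x y
        change inner ℂ (p (q * x)) (p y) = inner ℂ (p x) (p (q * y))
        rw [hpq, hpq, hp, hp, hin, hin, star_mul q, hqs, mul_assoc]
      · intro x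
        change ε * (inner ℂ (p x) (p x)).re ≤ (inner ℂ (p x) (p (q * x))).re
        rw [hre, hpq]
        exact hlow _
      · intro x
        change ‖inner ℂ η (p x)‖ ^ 2 ≤ ‖η‖ ^ 2 * (inner ℂ (p x) (p x)).re
        rw [hre, ← mul_pow]
        exact pow_le_pow_left₀ (norm_nonneg _) (norm_inner_le_norm _ _) 2
      · intro x
        exact hη0 x
      -- The Stieltjes condition is used at the vector `l.prod * b`, which is why it must hold for
      -- all vectors and not only for `1`.
      · rw [hp, hin] at hb
        have hk : ∀ n, (comapCore p).inner b ((LinearMap.mulLeft ℂ q ^ n) b) =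
            ω (star (l.prod * b) * (q ^ n * (l.prod * b))) := fun n => by
          rw [← hin, ← hpqn]; rfl
        simp only [hk]
        exact stieltjes_of_mem_posΩ hq (fun σ hσ => hst σ hσ q hqmem) hω hb
    have hCall : ∀ b, inner ℂ η (p b) = 0 := by
      intro b
      by_cases hb : p b = 0
      · rw [hb, inner_zero_right]
      · have hn : (‖p b‖ : ℂ) ≠ 0 := by exact_mod_cast norm_ne_zero_iff.2 hb
        have h1 := hC ((‖p b‖ : ℂ)⁻¹ • b) (by
          rw [map_smul, inner_smul_left, inner_smul_right, inner_self_eq_norm_sq_complex]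
          simp only [map_inv₀, Complex.conj_ofReal]
          field_simp)
        rw [map_smul, smul_eq_mul] at h1
        exact (mul_eq_zero.1 h1).resolve_left (inv_ne_zero hn)
    exact hdense.eq_zero_of_inner_left ℂ hCall

end GNS

end AbstractOStarAlgebra

/-! ### Positivity on the dominated subalgebra and its closure -/

namespace AbstractOStarAlgebra

variable {A : Type*} [Ring A] [StarRing A] [Algebra ℂ A] [StarModule ℂ A]
  {𝒜 : AbstractOStarAlgebra A}

theorem apply_nonneg_of_mem_down {Q' : Set A} (hne : Q'.Nonempty)
    (hcoer : ∀ q ∈ Q', 𝒜.Coercive q) (hcomm : ∀ q ∈ Q', ∀ r ∈ Q', Commute q r)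
    (hst : ∀ σ ∈ 𝒜.states, ∀ q ∈ Q', 𝒜.IsStieltjesState σ q)
    {ω : Module.Dual ℂ A} (hω : ω ∈ 𝒜.posΩ) {ρ : Module.Dual ℂ A} (hρH : ρ ∈ hermitianDual A)
    (hρ : AlgPositive ρ) (hωρ : AlgPositive (ω - ρ)) {a : A}
    (ha : a ∈ 𝒜.down (dominantSet Q')) (ha' : a ∈ 𝒜.pos) : 0 ≤ ρ a := by
  obtain ⟨H, _, _, _, π, hπ, hin⟩ := exists_denseRange_inner_eq
    (algPositiveCore ω hω.2.1 (𝒜.algPositive_of_mem hω))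
  replace hin : ∀ x y, inner ℂ (π x) (π y) = ω (star x * y) := hin
  have hn : ∀ x, ‖π x‖ ^ 2 = (ω (star x * x)).re := fun x => by
    rw [← inner_self_eq_norm_sq (𝕜 := ℂ), hin]; rfl
  obtain ⟨T, hT, hTin⟩ := exists_nonneg_inner_eq hπ (algPositiveCore ρ hρH hρ) fun x => by
    rw [hn]
    have := (Complex.le_def.1 (hωρ x)).1
    rw [LinearMap.sub_apply, Complex.sub_re] at this
    exact sub_nonneg.1 this
  replace hTin : ∀ x y, inner ℂ (T (π x)) (π y) = ρ (star x * y) := hTin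
  obtain ⟨q, hq⟩ := hne
  have hqs : star q = q := isSelfAdjoint_of_mem_pos (hcoer q hq).1
  have has : star a = a := isSelfAdjoint_of_mem_pos ha'
  -- One `q` suffices: `a* q² a ≲ r²` bounds `q a` by `r`, and coercivity of `q` removes `q` on the
  -- left.
  obtain ⟨r, ⟨t, l, ht, -, hl, rfl⟩, -, -, hle, -⟩ := ha q
    ⟨1, [q], le_rfl, by simp, by simpa using hq, by simp⟩
  have hlcoer : ∀ q ∈ l, 𝒜.Coercive q := fun q hq => hcoer q (hl q hq)
  have hlcomm : ∀ q ∈ l, ∀ r ∈ l, Commute q r := fun q hq r hr => hcomm q (hl q hq) r (hl r hr)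
  have hls : star l.prod = l.prod :=
    isSelfAdjoint_list_prod l (fun q hq => isSelfAdjoint_of_mem_pos (hlcoer q hq).1) hlcomm
  obtain ⟨M, -, hM⟩ := exists_norm_le_prod hω hin l hlcoer
  obtain ⟨M', hM0', hM'⟩ := exists_norm_le_of_coercive hω hin (hcoer q hq)
  -- The scalar `t` of `r` goes into the constant `M' * t`, and evaluation at `1` yields `ρ a`. Weak
  -- commutation with `T` is just associativity inside `ρ`.
  have key := inner_nonneg_of_weakly_commute (π := π) (p := π ∘ₗ LinearMap.mulLeft ℂ l.prod)
    (g := π ∘ₗ LinearMap.mulLeft ℂ a) (M := M) (M' := M' * t)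
    (denseRange_prod_mul hω hπ hin l hlcoer hlcomm fun σ hσ q hq => hst σ hσ q (hl q hq))
    hM ?_ ?_ ?_ hT ?_ ?_ 1
  · simpa [hTin] using key
  · intro x
    have h1 : ‖π (q * (a * x))‖ ≤ t * ‖π (l.prod * x)‖ := by
      rw [← pow_le_pow_iff_left₀ (norm_nonneg _) (by positivity) two_ne_zero, mul_pow, hn, hn]
      have h2 := (Complex.le_def.1 (apply_conj_le hω hle x)).1
      have h3 : star (q * (a * x)) * (q * (a * x)) = star x * (star a * q ^ 2 * a) * x := by
        rw [star_mul, star_mul, hqs]; noncomm_ring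
      have h4 : star x * ((t : ℂ) • l.prod) ^ 2 * x =
          ((t ^ 2 : ℝ) : ℂ) • (star (l.prod * x) * (l.prod * x)) := by
        rw [star_mul, hls, smul_pow, mul_smul_comm, smul_mul_assoc, sq l.prod]
        push_cast
        simp only [mul_assoc]
      rw [h4, map_smul, smul_eq_mul, Complex.re_ofReal_mul] at h2
      rw [h3]
      exact h2
    rw [mul_assoc]
    exact (hM' (a * x)).trans (mul_le_mul_of_nonneg_left h1 hM0')
  · intro x y
    simp only [LinearMap.comp_apply, LinearMap.mulLeft_apply, hin, star_mul, hls, mul_assoc]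
  · intro x
    simp only [LinearMap.comp_apply, LinearMap.mulLeft_apply, hin, star_mul, has]
    exact apply_nonneg hω (conj_mem_pos ha' x)
  · intro x y
    simp only [LinearMap.comp_apply, LinearMap.mulLeft_apply, hTin, star_mul, hls, mul_assoc]
  · intro x y
    simp only [LinearMap.comp_apply, LinearMap.mulLeft_apply, hTin, star_mul, has, mul_assoc]

/-- Algebraically positive functionals which are algebraically dominated by a positive functional
of `(A, Ω)` are strongly continuous. -/
theorem continuous_of_algPositive_sub {ω : Module.Dual ℂ A} (hω : ω ∈ 𝒜.posΩ)
    {ρ : Module.Dual ℂ A} (hρH : ρ ∈ hermitianDual A)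
    (hρ : AlgPositive ρ) (hωρ : AlgPositive (ω - ρ)) :
    @Continuous A ℂ 𝒜.strongTopology _ ρ := by
  let _ : TopologicalSpace A := 𝒜.strongTopology
  have hw : WithSeminorms 𝒜.stSeminorm := ⟨rfl⟩
  refine hw.continuous_normedSpace_rng ℂ ρ
    -- One seminorm is enough: `|ρ a|² ≤ ρ 1 · ρ (a* a) ≤ ρ 1 · ω (a* a)`.
    ⟨{⟨ω, hω⟩}, Real.toNNReal (Real.sqrt (ρ 1).re), fun a => ?_⟩
  rw [Finset.sup_singleton]
  change ‖ρ a‖ ≤ (Real.toNNReal (Real.sqrt (ρ 1).re) : ℝ) * Real.sqrt (ω (star a * a)).re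
  rw [Real.coe_toNNReal _ (Real.sqrt_nonneg _)]
  have h0 := (Complex.le_def.1 (hρ 1)).1
  rw [star_one, one_mul] at h0
  rw [← Real.sqrt_mul h0]
  refine Real.le_sqrt_of_sq_le ((norm_apply_sq_le hρH hρ a).trans
    (mul_le_mul_of_nonneg_left ?_ h0))
  have := (Complex.le_def.1 (hωρ a)).1
  rw [LinearMap.sub_apply, Complex.sub_re] at this
  exact sub_nonneg.1 this

theorem dualLE_of_algPositive_sub (hst : 𝒜.SufficientlyManyStieltjesStates)
    {ω : Module.Dual ℂ A} (hω : ω ∈ 𝒜.posΩ) {ρ : Module.Dual ℂ A} (hρH : ρ ∈ hermitianDual A)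
    (hρ : AlgPositive ρ) (hωρ : AlgPositive (ω - ρ)) : 𝒜.dualLE 0 ρ := by
  obtain ⟨Q', hne, -, hcoer, hcomm, hstates, hdense⟩ := hst
  intro a ha
  let _ : TopologicalSpace A := 𝒜.strongTopology
  have hclosed : IsClosed {x : A | 0 ≤ ρ x} :=
    isClosed_le continuous_const (continuous_of_algPositive_sub hω hρH hρ hωρ)
  exact closure_minimal (fun x hx => apply_nonneg_of_mem_down hne hcoer hcomm hstates hω hρH hρ
    hωρ hx.1 hx.2) hclosed (hdense ha)

end AbstractOStarAlgebra

end OStar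

end

theorem mainTheorem7 {A : Type*} [Ring A] [StarRing A] [Algebra ℂ A] [StarModule ℂ A]
    (𝒜 : OStar.AbstractOStarAlgebra A)
    (hdown : 𝒜.DownwardsClosed) (hst : 𝒜.SufficientlyManyStieltjesStates)
    (ω : Module.Dual ℂ A) (hω : ω ∈ 𝒜.posΩ)
    (ρ : Module.Dual ℂ A) (hρH : ρ ∈ OStar.hermitianDual A)
    (hρ : OStar.AlgPositive ρ) (hωρ : OStar.AlgPositive (ω - ρ)) :
    ρ ∈ 𝒜.posΩ ∧ 𝒜.dualLE 0 ρ ∧ 𝒜.dualLE ρ ω := by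
  have hH := OStar.sub_mem_hermitianDual hω.2.1 hρH
  have h1 : 𝒜.dualLE 0 ρ := OStar.AbstractOStarAlgebra.dualLE_of_algPositive_sub hst hω hρH hρ hωρ
  -- The hypotheses are symmetric under `ρ ↔ ω - ρ`.
  have h2 : 𝒜.dualLE 0 (ω - ρ) :=
    OStar.AbstractOStarAlgebra.dualLE_of_algPositive_sub hst hω hH hωρ (by simpa using hρ)
  refine ⟨hdown ρ ⟨hρH, h1⟩ ⟨ω, hω, hH, h2⟩, h1, fun a ha => ?_⟩
  have := h2 a ha
  rwa [LinearMap.sub_apply, LinearMap.zero_apply, sub_nonneg] at this
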